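/- There is an absolute constant $C$ with the following property. Let $n\ge 0$ be an integer, let $\mathcal T$ be a nonempty countable (finite or infinite) index set, and for $i\in\{1,\dots,n\}$ let $X_i=(X_{i,s})_{s\in\mathcal T}$ be a family of real-valued random variables on a common probability space such that the random vectors $X_1,\dots,X_n$ are independent (they need not be identically distributed, and the coordinates $X_{i,s}$, $s\in\mathcal T$, of one vector may be dependent). Assume that $\mathbb E X_{i,s}=0$ and $|X_{i,s}|\le 1$ almost surely for all $i$ and all $s\in\mathcal T$. Put $$Z=\sup_{s\in\mathcal T}\sum_{i=1}^n X_{i,s},\qquad \sigma^2=\sup_{s\in\mathcal T}\sum_{i=1}^n\mathbb E X_{i,s}^2 .$$ Then $$\operatorname{Var} Z\le 2\,\mathbb E Z+2\sigma^2+C\sqrt n .$$ -/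

import Mathlib

open MeasureTheory ProbabilityTheory

/-- The supremum `Z = sup_s ∑_i X_{i,s}` of the sums of a finite family of random vectors
`X_i = (X_{i,s})_s`, as a random variable on `Ω`. -/
noncomputable def empiricalSup {Ω T : Type*} {n : ℕ} (X : Fin n → T → Ω → ℝ) (ω : Ω) : ℝ :=
  ⨆ s : T, ∑ i : Fin n, X i s ω

/-- The quantity `σ² = sup_s ∑_i E X_{i,s}²`. -/
noncomputable def maxVariance {Ω T : Type*} [MeasurableSpace Ω] {n : ℕ}
    (P : Measure Ω) (X : Fin n → T → Ω → ℝ) : ℝ :=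
  ⨆ s : T, ∑ i : Fin n, ∫ ω, X i s ω ^ 2 ∂P

/-! By Efron–Stein, `Var Z` is at most the sum over `k` of `E V k`, where `V k` is the variance of
`Z` when only coordinate `k` is resampled; let `M k` be the corresponding mean. Fix `x` and any
index `s`. As a function of the new coordinate, `Z` dominates the sum `S s` with its `k`-th term
resampled, and exceeds `M k` by at most 1. Hence `V k ≤ E Y_{k,s}² + 2 (M k - S s + Y_{k,s}(x_k))`
(`variance_le_of_dominates`). Since `V k` and `M k` ignore `x_k`, the index `s` may be chosen
afterwards, nearly optimal at the full point `x`. Summing over `k` gives `∑ V k ≤ σ² + 2 ∑ M k - 2 n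
Z + 2 Z`. As `E M k = E Z`, the terms of order `n` cancel on integration, leaving `σ² + 2 E Z`. -/

section VarianceBounds

variable {A B E ι : Type*} [MeasurableSpace A] [MeasurableSpace B] [MeasurableSpace E]

/-! ### Moments of bounded functions -/

theorem integrable_of_abs_le {μ : Measure A} [IsFiniteMeasure μ] {f : A → ℝ} {K : ℝ}
    (hf : Measurable f) (hK : ∀ x, |f x| ≤ K) : Integrable f μ :=
  Integrable.of_bound hf.aestronglyMeasurable K (.of_forall hK)

theorem abs_integral_le_of_abs_le {μ : Measure A} [IsProbabilityMeasure μ] {f : A → ℝ} {K : ℝ}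
    (hK : ∀ x, |f x| ≤ K) : |∫ x, f x ∂μ| ≤ K := by
  simpa using norm_integral_le_of_norm_le_const (μ := μ) (f := f) (C := K) (.of_forall hK)

theorem abs_sq_le_of_abs_le {x K : ℝ} (h : |x| ≤ K) : |x ^ 2| ≤ K ^ 2 := by
  rw [abs_pow]
  exact pow_le_pow_left₀ (abs_nonneg x) h 2

theorem abs_mul_le_of_abs_le {x y K : ℝ} (hx : |x| ≤ K) (hy : |y| ≤ K) : |x * y| ≤ K * K := by
  rw [abs_mul]
  exact mul_le_mul hx hy (abs_nonneg y) ((abs_nonneg x).trans hx)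

theorem variance_eq_of_abs_le {μ : Measure A} [IsProbabilityMeasure μ] {f : A → ℝ} {K : ℝ}
    (hf : Measurable f) (hK : ∀ x, |f x| ≤ K) :
    variance f μ = ∫ x, f x ^ 2 ∂μ - (∫ x, f x ∂μ) ^ 2 := by
  rw [variance_eq_sub (MemLp.of_bound hf.aestronglyMeasurable K (.of_forall hK))]
  rfl

theorem abs_variance_le_of_abs_le {μ : Measure A} [IsProbabilityMeasure μ] {f : A → ℝ} {K : ℝ}
    (hf : Measurable f) (hK : ∀ x, |f x| ≤ K) : |variance f μ| ≤ K ^ 2 := by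
  rw [abs_of_nonneg (variance_nonneg f μ), variance_eq_of_abs_le hf hK]
  have h := abs_integral_le_of_abs_le (μ := μ) fun x => abs_sq_le_of_abs_le (hK x)
  nlinarith [le_abs_self (∫ x, f x ^ 2 ∂μ), sq_nonneg (∫ x, f x ∂μ)]

theorem measurable_integral_right {ν : Measure B} [SFinite ν] {f : A × B → ℝ}
    (hf : Measurable f) : Measurable fun a => ∫ b, f (a, b) ∂ν :=
  (hf.stronglyMeasurable.integral_prod_right' (ν := ν)).measurable

theorem measurable_variance_right {ν : Measure B} [IsProbabilityMeasure ν] {f : A × B → ℝ} {K : ℝ}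
    (hf : Measurable f) (hK : ∀ z, |f z| ≤ K) :
    Measurable fun a => variance (fun b => f (a, b)) ν := by
  have h : ∀ a, variance (fun b => f (a, b)) ν
      = ∫ b, f (a, b) ^ 2 ∂ν - (∫ b, f (a, b) ∂ν) ^ 2 := fun a =>
    variance_eq_of_abs_le (hf.comp measurable_prodMk_left) fun b => hK (a, b)
  simp_rw [h]
  exact (measurable_integral_right (f := fun z => f z ^ 2) (hf.pow_const 2)).sub
    ((measurable_integral_right hf).pow_const 2)

theorem integral_variance_right {μ : Measure A} {ν : Measure B} [IsProbabilityMeasure μ]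
    [IsProbabilityMeasure ν] {f : A × B → ℝ} {K : ℝ}
    (hf : Measurable f) (hK : ∀ z, |f z| ≤ K) :
    ∫ a, variance (fun b => f (a, b)) ν ∂μ
      = ∫ z, f z ^ 2 ∂μ.prod ν - ∫ a, (∫ b, f (a, b) ∂ν) ^ 2 ∂μ := by
  have h : ∀ a, variance (fun b => f (a, b)) ν
      = ∫ b, f (a, b) ^ 2 ∂ν - (∫ b, f (a, b) ∂ν) ^ 2 := fun a =>
    variance_eq_of_abs_le (hf.comp measurable_prodMk_left) fun b => hK (a, b)
  have hsq : Measurable fun z => f z ^ 2 := hf.pow_const 2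
  have hsqK : ∀ z, |f z ^ 2| ≤ K ^ 2 := fun z => abs_sq_le_of_abs_le (hK z)
  simp_rw [h]
  rw [integral_sub, integral_prod _ (integrable_of_abs_le hsq hsqK)]
  · exact integrable_of_abs_le (measurable_integral_right hsq)
      fun a => abs_integral_le_of_abs_le fun b => hsqK (a, b)
  · exact integrable_of_abs_le ((measurable_integral_right hf).pow_const 2)
      fun a => abs_sq_le_of_abs_le (abs_integral_le_of_abs_le fun b => hK (a, b))

/-! ### Tensorization of the variance -/

/-- The Efron–Stein inequality for two factors. -/
theorem variance_prod_le {μ : Measure A} {ν : Measure B} [IsProbabilityMeasure μ]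
    [IsProbabilityMeasure ν] {f : A × B → ℝ} {K : ℝ}
    (hf : Measurable f) (hK : ∀ z, |f z| ≤ K) :
    variance f (μ.prod ν) ≤ ∫ b, variance (fun a => f (a, b)) μ ∂ν
      + ∫ a, variance (fun b => f (a, b)) ν ∂μ := by
  have hfs : Measurable fun z : B × A => f z.swap := hf.comp measurable_swap
  have hswap := integral_variance_right (μ := ν) (ν := μ) hfs fun z => hK z.swap
  simp only [Prod.swap_prod_mk] at hswap
  rw [variance_eq_of_abs_le hf hK, integral_variance_right hf hK, hswap,
    integral_prod_swap (μ := μ) (ν := ν) (fun z => f z ^ 2)]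
  set h : B → ℝ := fun b => ∫ a, f (a, b) ∂μ with hh
  set r : A → ℝ := fun a => ∫ b, f (a, b) ∂ν with hr
  set m : ℝ := ∫ z, f z ∂μ.prod ν with hm
  have mh : Measurable h := measurable_integral_right hfs
  have mr : Measurable r := measurable_integral_right hf
  have hhK : ∀ b, |h b| ≤ K := fun b => abs_integral_le_of_abs_le fun a => hK (a, b)
  have hrK : ∀ a, |r a| ≤ K := fun a => abs_integral_le_of_abs_le fun b => hK (a, b)
  have mh' : Measurable fun z : A × B => h z.2 := mh.comp measurable_snd
  have mr' : Measurable fun z : A × B => r z.1 := mr.comp measurable_fst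
  have If : Integrable f (μ.prod ν) := integrable_of_abs_le hf hK
  have Ih : Integrable (fun z : A × B => h z.2) (μ.prod ν) :=
    integrable_of_abs_le mh' fun z => hhK z.2
  have Ir : Integrable (fun z : A × B => r z.1) (μ.prod ν) :=
    integrable_of_abs_le mr' fun z => hrK z.1
  have Iff : Integrable (fun z => f z ^ 2) (μ.prod ν) :=
    integrable_of_abs_le (hf.pow_const 2) fun z => abs_sq_le_of_abs_le (hK z)
  have Ihh : Integrable (fun z : A × B => h z.2 ^ 2) (μ.prod ν) :=
    integrable_of_abs_le (mh'.pow_const 2) fun z => abs_sq_le_of_abs_le (hhK z.2)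
  have Irr : Integrable (fun z : A × B => r z.1 ^ 2) (μ.prod ν) :=
    integrable_of_abs_le (mr'.pow_const 2) fun z => abs_sq_le_of_abs_le (hrK z.1)
  have Ifh : Integrable (fun z : A × B => f z * h z.2) (μ.prod ν) :=
    integrable_of_abs_le (hf.mul mh') fun z => abs_mul_le_of_abs_le (hK z) (hhK z.2)
  have Ifr : Integrable (fun z : A × B => f z * r z.1) (μ.prod ν) :=
    integrable_of_abs_le (hf.mul mr') fun z => abs_mul_le_of_abs_le (hK z) (hrK z.1)
  have Irh : Integrable (fun z : A × B => r z.1 * h z.2) (μ.prod ν) :=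
    integrable_of_abs_le (mr'.mul mh') fun z => abs_mul_le_of_abs_le (hrK z.1) (hhK z.2)
  have eh : ∫ b, h b ∂ν = m := by rw [hm, integral_prod_symm _ If]
  have er : ∫ a, r a ∂μ = m := by rw [hm, integral_prod _ If]
  have eh' : ∫ z : A × B, h z.2 ∂μ.prod ν = m := by rw [integral_fun_snd]; simpa using eh
  have er' : ∫ z : A × B, r z.1 ∂μ.prod ν = m := by rw [integral_fun_fst]; simpa using er
  have ehh : ∫ z : A × B, h z.2 ^ 2 ∂μ.prod ν = ∫ b, h b ^ 2 ∂ν := by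
    rw [integral_fun_snd fun b => h b ^ 2]; simp
  have err : ∫ z : A × B, r z.1 ^ 2 ∂μ.prod ν = ∫ a, r a ^ 2 ∂μ := by
    rw [integral_fun_fst fun a => r a ^ 2]; simp
  have efh : ∫ z : A × B, f z * h z.2 ∂μ.prod ν = ∫ b, h b ^ 2 ∂ν := by
    rw [integral_prod_symm _ Ifh]
    refine integral_congr_ae (.of_forall fun b => ?_)
    simp only [integral_mul_const, hh, sq]
  have efr : ∫ z : A × B, f z * r z.1 ∂μ.prod ν = ∫ a, r a ^ 2 ∂μ := by
    rw [integral_prod _ Ifr]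
    refine integral_congr_ae (.of_forall fun a => ?_)
    simp only [integral_mul_const, hr, sq]
  have erh : ∫ z : A × B, r z.1 * h z.2 ∂μ.prod ν = m ^ 2 := by
    rw [integral_prod_mul, er, eh, sq]
  -- The integrand is the square of the pure interaction term in the Hoeffding decomposition of `f`.
  -- Its integral is exactly the gap in the inequality.
  have key : 0 ≤ ∫ z : A × B, (f z - h z.2 - r z.1 + m) ^ 2 ∂μ.prod ν :=
    integral_nonneg fun z => sq_nonneg _
  have expand : ∫ z : A × B, (f z - h z.2 - r z.1 + m) ^ 2 ∂μ.prod ν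
      = ∫ z, f z ^ 2 ∂μ.prod ν - ∫ b, h b ^ 2 ∂ν - ∫ a, r a ^ 2 ∂μ + m ^ 2 := by
    have e : ∀ z : A × B, (f z - h z.2 - r z.1 + m) ^ 2
        = (f z ^ 2 + h z.2 ^ 2 + r z.1 ^ 2 + m ^ 2 + 2 * m * f z + 2 * (r z.1 * h z.2))
          - (2 * (f z * h z.2) + 2 * (f z * r z.1) + 2 * m * h z.2 + 2 * m * r z.1) :=
      fun z => by ring
    simp_rw [e]
    have Jfh := Ifh.const_mul 2
    have Jfr := Ifr.const_mul 2
    have Jh := Ih.const_mul (2 * m)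
    have Jr := Ir.const_mul (2 * m)
    have J2 : Integrable (fun z : A × B => 2 * (f z * h z.2) + 2 * (f z * r z.1)) (μ.prod ν) :=
      Jfh.add Jfr
    have J3 : Integrable (fun z : A × B => 2 * (f z * h z.2) + 2 * (f z * r z.1)
        + 2 * m * h z.2) (μ.prod ν) := J2.add Jh
    have J4 : Integrable (fun z : A × B => 2 * (f z * h z.2) + 2 * (f z * r z.1)
        + 2 * m * h z.2 + 2 * m * r z.1) (μ.prod ν) := J3.add Jr
    rw [integral_sub (by fun_prop) J4,
      integral_add (by fun_prop) (by fun_prop), integral_add (by fun_prop) (by fun_prop),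
      integral_add (by fun_prop) (by fun_prop), integral_add (by fun_prop) (by fun_prop),
      integral_add (by fun_prop) (by fun_prop), integral_add J3 Jr, integral_add J2 Jh,
      integral_add Jfh Jfr]
    simp only [integral_const_mul, ehh, err, efh, efr, erh, eh', er', ← hm, integral_const,
      probReal_univ, smul_eq_mul]
    ring
  linarith

/-- The Efron–Stein inequality for bounded functions on a finite product. -/
theorem variance_pi_le : ∀ {n : ℕ} (μ : Fin n → Measure E) [∀ i, IsProbabilityMeasure (μ i)]
    {f : (Fin n → E) → ℝ} {K : ℝ} (_ : Measurable f) (_ : ∀ x, |f x| ≤ K),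
    variance f (Measure.pi μ)
      ≤ ∑ k, ∫ x, variance (fun y => f (Function.update x k y)) (μ k) ∂Measure.pi μ := by
  intro n
  induction n with
  | zero =>
    intro μ _ f K hf hK
    have : f = fun _ => f default := funext fun x => congrArg f (Subsingleton.elim _ _)
    rw [this]
    simp [variance_eq_of_abs_le (measurable_const (a := f default)) (fun _ => hK default)]
  | succ n ih =>
    intro μ _ f K hf hK
    have mp := (measurePreserving_piFinSuccAbove μ 0).symm
    have hcons : ∀ z : E × (Fin n → E), (MeasurableEquiv.piFinSuccAbove (fun _ => E) 0).symm z
        = Fin.cons z.1 z.2 := fun z => Fin.insertNth_zero' z.1 z.2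
    have hint : ∀ g : (Fin (n + 1) → E) → ℝ, ∫ x, g x ∂Measure.pi μ
        = ∫ z, g (Fin.cons z.1 z.2) ∂(μ 0).prod (Measure.pi fun i : Fin n => μ i.succ) := by
      intro g
      rw [← mp.integral_comp' (g := g)]
      simp only [hcons]
      rfl
    have mcons : Measurable fun z : E × (Fin n → E) => (Fin.cons z.1 z.2 : Fin (n + 1) → E) := by
      simp_rw [← hcons]
      exact mp.measurable
    set g : E × (Fin n → E) → ℝ := fun z => f (Fin.cons z.1 z.2) with hg
    have mg : Measurable g := hf.comp mcons
    have hgK : ∀ z, |g z| ≤ K := fun z => hK _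
    have hvar : variance f (Measure.pi μ)
        = variance g ((μ 0).prod (Measure.pi fun i : Fin n => μ i.succ)) := by
      rw [variance_eq_of_abs_le hf hK, variance_eq_of_abs_le mg hgK, hint, hint]
    rw [hvar, Fin.sum_univ_succ]
    -- The term resampling coordinate 0 agrees exactly; the other is bounded by induction with
    -- coordinate 0 frozen.
    refine (variance_prod_le mg hgK).trans (add_le_add (le_of_eq ?_) ?_)
    · rw [hint]
      simp only [Fin.update_cons_zero]
      rw [integral_fun_snd fun b => variance (fun y => f (Fin.cons y b)) (μ 0)]
      simp [hg]
    · have mv : ∀ k : Fin n, Measurable fun z : E × (Fin n → E) =>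
          variance (fun y => g (z.1, Function.update z.2 k y)) (μ k.succ) := by
        intro k
        refine measurable_variance_right
          (f := fun w : (E × (Fin n → E)) × E => g (w.1.1, Function.update w.1.2 k w.2))
          (mg.comp ?_) fun w => hgK _
        refine (measurable_fst.comp measurable_fst).prodMk ?_
        exact measurable_update'.comp ((measurable_snd.comp measurable_fst).prodMk measurable_snd)
      have bv : ∀ (k : Fin n) (z : E × (Fin n → E)),
          |variance (fun y => g (z.1, Function.update z.2 k y)) (μ k.succ)| ≤ K ^ 2 :=
        fun k z => abs_variance_le_of_abs_le
          (mg.comp (measurable_prodMk_left.comp (measurable_update z.2))) fun y => hgK _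
      have e : ∀ k : Fin n,
          ∫ x, variance (fun y => f (Function.update x k.succ y)) (μ k.succ) ∂Measure.pi μ
          = ∫ a, ∫ b, variance (fun y => g (a, Function.update b k y)) (μ k.succ)
            ∂(Measure.pi fun i : Fin n => μ i.succ) ∂μ 0 := by
        intro k
        rw [hint, ← integral_prod _ (integrable_of_abs_le (mv k) (bv k))]
        simp only [hg, Fin.cons_update]
      simp_rw [e]
      rw [← integral_finsetSum]
      · refine integral_mono ?_ ?_ fun a => ?_
        · exact integrable_of_abs_le (measurable_variance_right mg hgK) fun a =>
            abs_variance_le_of_abs_le (mg.comp measurable_prodMk_left) fun b => hgK _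
        · exact integrable_finsetSum _ fun k _ => integrable_of_abs_le
            (measurable_integral_right (mv k)) fun a => abs_integral_le_of_abs_le fun b => bv k (a, b)
        · exact ih (fun i => μ i.succ) (mg.comp measurable_prodMk_left) fun b => hgK (a, b)
      · exact fun k _ => integrable_of_abs_le (measurable_integral_right (mv k))
          fun a => abs_integral_le_of_abs_le fun b => bv k (a, b)

/-! ### Resampling invariance -/

/-- Resampling one coordinate of a product measure. -/
theorem measurePreserving_update [Fintype ι] [DecidableEq ι] (μ : ι → Measure E)
    [∀ i, IsProbabilityMeasure (μ i)] (k : ι) :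
    MeasurePreserving (fun z : (ι → E) × E => Function.update z.1 k z.2)
      ((Measure.pi μ).prod (μ k)) (Measure.pi μ) := by
  refine ⟨measurable_update', (Measure.pi_eq fun s hs => ?_).symm⟩
  rw [Measure.map_apply measurable_update' (MeasurableSet.univ_pi hs)]
  -- The constraint on coordinate `k` passes to the fresh variable; the overwritten one is free and
  -- has mass 1.
  have : (fun z : (ι → E) × E => Function.update z.1 k z.2) ⁻¹' Set.univ.pi s
      = (Set.univ.pi (Function.update s k Set.univ)) ×ˢ s k := by
    ext z
    simp only [Set.mem_preimage, Set.mem_pi, Set.mem_univ, true_implies, Set.mem_prod]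
    constructor
    · intro h
      refine ⟨fun i => ?_, by simpa using h k⟩
      by_cases hi : i = k
      · subst hi; simp
      · simpa [hi] using h i
    · rintro ⟨h, hk⟩ i
      by_cases hi : i = k
      · subst hi; simpa using hk
      · simpa [hi] using h i
  rw [this, Measure.prod_prod, Measure.pi_pi, ← Finset.mul_prod_erase _ _ (Finset.mem_univ k),
    ← Finset.mul_prod_erase _ (fun i => μ i (s i)) (Finset.mem_univ k)]
  simp only [Function.update_self, measure_univ, one_mul]
  rw [mul_comm]
  congr 1
  refine Finset.prod_congr rfl fun i hi => ?_
  rw [Function.update_of_ne (Finset.ne_of_mem_erase hi)]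

/-- This yields `E M k = E Z`, the source of the final cancellation. -/
theorem integral_integral_update [Fintype ι] [DecidableEq ι] (μ : ι → Measure E)
    [∀ i, IsProbabilityMeasure (μ i)] (k : ι) {f : (ι → E) → ℝ} {K : ℝ}
    (hf : Measurable f) (hK : ∀ x, |f x| ≤ K) :
    ∫ x, ∫ y, f (Function.update x k y) ∂μ k ∂Measure.pi μ = ∫ x, f x ∂Measure.pi μ := by
  have mp := measurePreserving_update μ k
  rw [← integral_prod (fun z : (ι → E) × E => f (Function.update z.1 k z.2))
    (integrable_of_abs_le (hf.comp measurable_update') fun z => hK _)]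
  rw [← mp.map_eq, integral_map mp.measurable.aemeasurable hf.aestronglyMeasurable, mp.map_eq]

/-! ### Variance of suprema over product spaces -/

/-- A function that exceeds its mean by at most one and dominates a shift of a centered function
bounded by one has a variance controlled by that of the centered function and by the gap. -/
theorem variance_le_of_dominates {μ : Measure E} [IsProbabilityMeasure μ] {z Y : E → ℝ} {K w : ℝ}
    (hz : Measurable z) (hzK : ∀ y, |z y| ≤ K) (hY : Measurable Y) (hY1 : ∀ y, |Y y| ≤ 1)
    (hY0 : ∫ y, Y y ∂μ = 0) (hw : ∀ y, w + Y y ≤ z y) (hz1 : ∀ y, z y ≤ ∫ y, z y ∂μ + 1) :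
    variance z μ ≤ ∫ y, Y y ^ 2 ∂μ + 2 * (∫ y, z y ∂μ - w) := by
  rw [variance_eq_of_abs_le hz hzK]
  set m := ∫ y, z y ∂μ with hm
  have Iz : Integrable z μ := integrable_of_abs_le hz hzK
  have IY : Integrable Y μ := integrable_of_abs_le hY hY1
  have Izz : Integrable (fun y => z y ^ 2) μ :=
    integrable_of_abs_le (hz.pow_const 2) fun y => abs_sq_le_of_abs_le (hzK y)
  have IYY : Integrable (fun y => Y y ^ 2) μ :=
    integrable_of_abs_le (hY.pow_const 2) fun y => abs_sq_le_of_abs_le (hY1 y)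
  -- The first factor is nonnegative by domination, the second because `z ≤ m + 1` and `Y ≤ 1`.
  -- Expanding with `∫ Y = 0` gives the claim.
  have key : 0 ≤ ∫ y, (z y - Y y - w) * (2 + m - z y - Y y) ∂μ :=
    integral_nonneg fun y => mul_nonneg (by linarith [hw y])
      (by linarith [hz1 y, (abs_le.1 (hY1 y)).2])
  have e : ∀ y, (z y - Y y - w) * (2 + m - z y - Y y)
      = ((2 + m + w) * z y + Y y ^ 2) - (z y ^ 2 + (2 + m - w) * Y y + w * (2 + m)) :=
    fun y => by ring
  simp_rw [e] at key
  rw [integral_sub (by fun_prop) (by fun_prop), integral_add (by fun_prop) (by fun_prop),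
    integral_add (by fun_prop) (by fun_prop), integral_add (by fun_prop) (by fun_prop)] at key
  simp only [integral_const_mul, hY0, ← hm, integral_const, probReal_univ, smul_eq_mul] at key
  nlinarith [key]

/-- The variance bound for suprema of sums over a product space. -/
theorem variance_iSup_sum_pi_le {n : ℕ} {T : Type*} [Countable T] [Nonempty T]
    (μ : Fin n → Measure E) [∀ i, IsProbabilityMeasure (μ i)] {Y : Fin n → T → E → ℝ} {v : ℝ}
    (hY : ∀ i s, Measurable (Y i s)) (hY1 : ∀ i s y, |Y i s y| ≤ 1)
    (hY0 : ∀ i s, ∫ y, Y i s y ∂μ i = 0) (hv : ∀ s, ∑ i, ∫ y, Y i s y ^ 2 ∂μ i ≤ v) :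
    variance (fun x : Fin n → E => ⨆ s, ∑ i, Y i s (x i)) (Measure.pi μ)
      ≤ 2 * ∫ x : Fin n → E, (⨆ s, ∑ i, Y i s (x i)) ∂Measure.pi μ + v := by
  set S : T → (Fin n → E) → ℝ := fun s x => ∑ i, Y i s (x i) with hS
  set Z : (Fin n → E) → ℝ := fun x => ⨆ s, S s x with hZ
  have hSn : ∀ s x, |S s x| ≤ n := fun s x => by
    refine (Finset.abs_sum_le_sum_abs _ _).trans ?_
    simpa using Finset.sum_le_sum fun i (_ : i ∈ Finset.univ) => hY1 i s (x i)
  have bdd : ∀ x, BddAbove (Set.range fun s => S s x) := fun x =>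
    ⟨n, by rintro _ ⟨s, rfl⟩; exact (abs_le.1 (hSn s x)).2⟩
  have SZ : ∀ s x, S s x ≤ Z x := fun s x => le_ciSup (bdd x) s
  have mS : ∀ s, Measurable (S s) := fun s =>
    Finset.measurable_sum _ fun i _ => (hY i s).comp (measurable_pi_apply i)
  have mZ : Measurable Z := Measurable.iSup mS
  have ZK : ∀ x, |Z x| ≤ n := fun x => abs_le.2
    ⟨((abs_le.1 (hSn (Classical.arbitrary T) x)).1).trans (SZ _ x),
      ciSup_le fun s => (abs_le.1 (hSn s x)).2⟩
  have S_update : ∀ s x k y, S s (Function.update x k y) = S s x - Y k s (x k) + Y k s y := by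
    intro s x k y
    simp only [hS]
    rw [← Finset.add_sum_erase _ _ (Finset.mem_univ k),
      ← Finset.add_sum_erase _ (fun i => Y i s (x i)) (Finset.mem_univ k), Function.update_self]
    have : ∑ i ∈ Finset.univ.erase k, Y i s (Function.update x k y i)
        = ∑ i ∈ Finset.univ.erase k, Y i s (x i) :=
      Finset.sum_congr rfl fun i hi => by rw [Function.update_of_ne (Finset.ne_of_mem_erase hi)]
    rw [this]; ring
  set M : Fin n → (Fin n → E) → ℝ := fun k x => ∫ y, Z (Function.update x k y) ∂μ k with hM
  set V : Fin n → (Fin n → E) → ℝ :=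
    fun k x => variance (fun y => Z (Function.update x k y)) (μ k) with hV
  have mZu : ∀ k, Measurable fun z : (Fin n → E) × E => Z (Function.update z.1 k z.2) :=
    fun k => mZ.comp measurable_update'
  have mM : ∀ k, Measurable (M k) := fun k => measurable_integral_right (mZu k)
  have mV : ∀ k, Measurable (V k) := fun k => measurable_variance_right
    (f := fun z : (Fin n → E) × E => Z (Function.update z.1 k z.2)) (K := n) (mZu k) fun z => ZK _
  have IM : ∀ k, Integrable (M k) (Measure.pi μ) := fun k =>
    integrable_of_abs_le (mM k) fun x => abs_integral_le_of_abs_le fun y => ZK _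
  have IV : ∀ k, Integrable (V k) (Measure.pi μ) := fun k =>
    integrable_of_abs_le (mV k) fun x => abs_variance_le_of_abs_le
      (mZ.comp (measurable_update x)) fun y => ZK _
  have IZ : Integrable Z (Measure.pi μ) := integrable_of_abs_le mZ ZK
  have hVk : ∀ k s x, V k x ≤ ∫ y, Y k s y ^ 2 ∂μ k + 2 * (M k x - (S s x - Y k s (x k))) := by
    intro k s x
    refine variance_le_of_dominates (mZ.comp (measurable_update x)) (fun y => ZK _) (hY k s)
      (hY1 k s) (hY0 k s) (fun y => (S_update s x k y).symm.trans_le (SZ s _)) fun y => ?_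
    refine ciSup_le fun t => ?_
    -- Averaging `S t ≤ Z` over the fresh coordinate removes the centered term, so resampling adds
    -- at most 1 to a quantity below `M k x`.
    have ht : S t x - Y k t (x k) ≤ M k x := by
      have IY : Integrable (Y k t) (μ k) := integrable_of_abs_le (hY k t) (hY1 k t)
      have : ∫ y, (S t x - Y k t (x k) + Y k t y) ∂μ k ≤ M k x :=
        integral_mono ((integrable_const _).add IY)
          (integrable_of_abs_le (mZ.comp (measurable_update x)) fun y => ZK _)
          fun y => (S_update t x k y).symm.trans_le (SZ t _)
      rwa [integral_add (integrable_const _) IY, hY0 k t, integral_const, probReal_univ, one_smul,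
        add_zero] at this
    rw [S_update]
    exact add_le_add ht (abs_le.1 (hY1 k t y)).2
  have hVs : ∀ s x, ∑ k, V k x ≤ v + 2 * ∑ k, M k x - 2 * (n * S s x) + 2 * S s x := by
    intro s x
    refine (Finset.sum_le_sum fun k _ => hVk k s x).trans ?_
    rw [Finset.sum_add_distrib, ← Finset.mul_sum, Finset.sum_sub_distrib, Finset.sum_sub_distrib,
      Finset.sum_const, Finset.card_univ, Fintype.card_fin, nsmul_eq_mul]
    have : ∑ k, Y k s (x k) = S s x := rfl
    rw [this]
    linarith [hv s]
  have hVZ : ∀ x, ∑ k, V k x ≤ v + 2 * ∑ k, M k x - 2 * (n * Z x) + 2 * Z x := by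
    intro x
    -- Bounding the lone `S s x` by `Z x` leaves `s` only in `n * S s x`, so the supremum can be
    -- taken without selecting a maximizer.
    have : n * Z x ≤ (v + 2 * ∑ k, M k x + 2 * Z x - ∑ k, V k x) / 2 := by
      rw [hZ, Real.mul_iSup_of_nonneg n.cast_nonneg]
      exact ciSup_le fun s => by linarith [hVs s x, SZ s x]
    linarith
  have hM_int : ∀ k, ∫ x, M k x ∂Measure.pi μ = ∫ x, Z x ∂Measure.pi μ :=
    fun k => integral_integral_update μ k mZ ZK
  have IMs : Integrable (fun x => ∑ k, M k x) (Measure.pi μ) := integrable_finsetSum _ fun k _ => IM k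
  calc variance Z (Measure.pi μ) ≤ ∑ k, ∫ x, V k x ∂Measure.pi μ := variance_pi_le μ mZ ZK
    _ = ∫ x, ∑ k, V k x ∂Measure.pi μ := (integral_finsetSum _ fun k _ => IV k).symm
    _ ≤ ∫ x, (v + 2 * ∑ k, M k x - 2 * (n * Z x) + 2 * Z x) ∂Measure.pi μ :=
      integral_mono (integrable_finsetSum _ fun k _ => IV k) (by fun_prop) hVZ
    _ = 2 * ∫ x, Z x ∂Measure.pi μ + v := by
      rw [integral_add (by fun_prop) (by fun_prop), integral_sub (by fun_prop) (by fun_prop),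
        integral_add (by fun_prop) (by fun_prop)]
      simp only [integral_const_mul]
      rw [integral_finsetSum _ fun k _ => IM k]
      simp only [hM_int, integral_const, probReal_univ, one_smul, Finset.sum_const,
        Finset.card_univ, Fintype.card_fin, nsmul_eq_mul]
      ring

end VarianceBounds

/-! ### Transfer to independent random vectors -/

theorem mainTheorem6 :
    ∃ C : ℝ, ∀ (n : ℕ) (T : Type*) [Countable T] [Nonempty T]
      (Ω : Type*) [MeasurableSpace Ω] (P : Measure Ω) [IsProbabilityMeasure P]
      (X : Fin n → T → Ω → ℝ),
      (∀ i s, Measurable (X i s)) →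
      iIndepFun (fun (i : Fin n) (ω : Ω) (s : T) => X i s ω) P →
      (∀ i s, ∫ ω, X i s ω ∂P = 0) →
      (∀ i s, ∀ᵐ ω ∂P, |X i s ω| ≤ 1) →
      variance (empiricalSup X) P ≤
        2 * ∫ ω, empiricalSup X ω ∂P + 2 * maxVariance P X + C * Real.sqrt n := by
  -- No `√n` term is needed: the bound obtained is `2 E Z + σ²`.
  refine ⟨0, fun n T _ _ Ω _ P _ X hX hindep hmean hbound => ?_⟩
  -- Clipping to `[-1, 1]` turns the almost sure bound into a pointwise one; countability of `T`
  -- makes the clipped and original suprema agree almost surely.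
  set c : ℝ → ℝ := fun t => max (-1) (min t 1) with hc
  have mc : Measurable c := measurable_const.max (measurable_id.min measurable_const)
  have hc1 : ∀ t, |c t| ≤ 1 := fun t =>
    abs_le.2 ⟨le_max_left _ _, max_le (by norm_num) (min_le_right _ _)⟩
  have hc_eq : ∀ t, |t| ≤ 1 → c t = t := fun t ht => by
    simp only [hc]
    rw [min_eq_left (abs_le.1 ht).2, max_eq_right (abs_le.1 ht).1]
  set ξ : Fin n → Ω → T → ℝ := fun i ω s => X i s ω with hξ
  have mξ : ∀ i, Measurable (ξ i) := fun i => measurable_pi_lambda _ fun s => hX i s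
  set μ : Fin n → Measure (T → ℝ) := fun i => P.map (ξ i) with hμ
  have : ∀ i, IsProbabilityMeasure (μ i) := fun i =>
    Measure.isProbabilityMeasure_map (mξ i).aemeasurable
  have hmap : P.map (fun ω i => ξ i ω) = Measure.pi μ :=
    (iIndepFun_iff_map_fun_eq_pi_map fun i => (mξ i).aemeasurable).1 hindep
  have mξ' : Measurable fun ω i => ξ i ω := measurable_pi_lambda _ mξ
  set Y : Fin n → T → (T → ℝ) → ℝ := fun _ s x => c (x s) with hYdef
  have mY : ∀ i s, Measurable (Y i s) := fun i s => mc.comp (measurable_pi_apply s)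
  have hXc : ∀ i s, (fun ω => Y i s (ξ i ω)) =ᵐ[P] X i s := fun i s => by
    filter_upwards [hbound i s] with ω hω using hc_eq _ hω
  have hmean' : ∀ i s, ∫ y, Y i s y ∂μ i = 0 := fun i s => by
    rw [integral_map (mξ i).aemeasurable (mY i s).aestronglyMeasurable,
      integral_congr_ae (hXc i s), hmean i s]
  have hsq : ∀ i s, ∫ y, Y i s y ^ 2 ∂μ i = ∫ ω, X i s ω ^ 2 ∂P := fun i s => by
    rw [integral_map (mξ i).aemeasurable ((mY i s).pow_const 2).aestronglyMeasurable]
    refine integral_congr_ae ?_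
    filter_upwards [hXc i s] with ω hω
    rw [hω]
  have hsq1 : ∀ i s, ∫ ω, X i s ω ^ 2 ∂P ≤ 1 := fun i s => by
    rw [← hsq]
    simpa using (le_abs_self _).trans (abs_integral_le_of_abs_le (μ := μ i)
      fun y => abs_sq_le_of_abs_le (hc1 (y s)))
  have hbdd : BddAbove (Set.range fun s => ∑ i, ∫ ω, X i s ω ^ 2 ∂P) := by
    refine ⟨n, ?_⟩
    rintro _ ⟨s, rfl⟩
    simpa using Finset.sum_le_sum fun i (_ : i ∈ Finset.univ) => hsq1 i s
  have hv : ∀ s, ∑ i, ∫ y, Y i s y ^ 2 ∂μ i ≤ maxVariance P X := fun s => by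
    simp_rw [hsq]
    exact le_ciSup hbdd s
  have hnonneg : 0 ≤ maxVariance P X := Real.iSup_nonneg fun s =>
    Finset.sum_nonneg fun i _ => integral_nonneg fun ω => sq_nonneg _
  have hZ : (fun ω => ⨆ s, ∑ i, Y i s (ξ i ω)) =ᵐ[P] empiricalSup X := by
    have : ∀ᵐ ω ∂P, ∀ i s, Y i s (ξ i ω) = X i s ω :=
      ae_all_iff.2 fun i => ae_all_iff.2 fun s => hXc i s
    filter_upwards [this] with ω hω
    simp only [empiricalSup, hω]
  have mZ : Measurable fun x : Fin n → T → ℝ => ⨆ s, ∑ i, Y i s (x i) :=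
    Measurable.iSup fun s => Finset.measurable_sum _ fun i _ =>
      (mY i s).comp (measurable_pi_apply i)
  have main := variance_iSup_sum_pi_le μ mY (fun _ s x => hc1 (x s)) hmean' hv
  rw [← hmap, variance_map mZ.aemeasurable mξ'.aemeasurable,
    integral_map mξ'.aemeasurable mZ.aestronglyMeasurable, integral_congr_ae hZ,
    variance_congr (X := (fun x : Fin n → T → ℝ => ⨆ s, ∑ i, Y i s (x i)) ∘ fun ω i => ξ i ω)
      (Y := empiricalSup X) hZ] at main
  linarith
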